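/- Let $d\ge 1$, $s\ge 0$ and $q$ be integers and let $p$ be a real number with $p>2$ and $q<p<2q$. Let $\Omega=[0,1]^d$, and let $W^{s,p}(\Omega)$ be the Sobolev space of all $f\in L^p(\Omega)$ whose weak derivatives $D^\alpha f$, $|\alpha|\le s$, exist and lie in $L^p(\Omega)$, with norm $\|f\|_{W^{s,p}(\Omega)}=\sum_{|\alpha|\le s}\|D^\alpha f\|_{L^p(\Omega)}$. For $f\in W^{s,p}(\Omega)$ put $I_f^q=\int_\Omega f(x)^q\,dx$. Let $R\in(0,\infty]$. Then there is a constant $c>0$, depending only on $d,s,p,q,R$, such that for every $n\ge 1$ $$\inf_{\hat H}\ \sup_{f\in W^{s,p}(\Omega),\ \|f\|_{W^{s,p}(\Omega)}\le R}\ \mathbb E\Big[\big|\hat H\big(x_1,\dots,x_n,f(x_1),\dots,f(x_n)\big)-I_f^q\big|\Big]\ \ge\ c\,n^{\max\{-q(s/d-1/p)-1,\ -1/2-s/d\}},$$ where $x_1,\dots,x_n$ are independent and uniformly distributed on $\Omega$ and the infimum is over all measurable functions $\hat H:\Omega^n\times\mathbb R^n\to\mathbb R$. For $R=\infty$ the supremum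 is over the whole space $W^{s,p}(\Omega)$. -/

import Mathlib

open MeasureTheory Set
open scoped ENNReal ContDiff

noncomputable section

/-- The closed unit cube `Ω = [0,1]^d`. -/
def unitCube (d : ℕ) : Set (Fin d → ℝ) := Set.Icc 0 1

/-- The uniform distribution on `Ω = [0,1]^d`: Lebesgue measure restricted to the cube
(which has volume one). -/
def uniformCube (d : ℕ) : Measure (Fin d → ℝ) := volume.restrict (unitCube d)

instance (d : ℕ) : IsProbabilityMeasure (uniformCube d) := by
  constructor
  rw [uniformCube, Measure.restrict_apply_univ, unitCube, Real.volume_Icc_pi]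
  simp

/-- The partial derivative `∂φ/∂x_i`. -/
def partialDeriv {d : ℕ} (i : Fin d) (φ : (Fin d → ℝ) → ℝ) : (Fin d → ℝ) → ℝ :=
  fun x => fderiv ℝ φ x (Pi.single i 1)

/-- The classical derivative `D^α φ = ∂_1^{α_1} ⋯ ∂_d^{α_d} φ` for a multi-index `α`
(used for smooth `φ` only). -/
def multiDeriv {d : ℕ} (α : Fin d → ℕ) (φ : (Fin d → ℝ) → ℝ) : (Fin d → ℝ) → ℝ :=
  (List.finRange d).foldr (fun i ψ => (partialDeriv i)^[α i] ψ) φ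

/-- `g` is the weak derivative `D^α f` in the interior of the unit cube: both functions are locally
integrable there and `∫_Ω f D^α φ = (-1)^{|α|} ∫_Ω g φ` for every smooth `φ` with compact support
in the interior of the cube. -/
def IsWeakDeriv {d : ℕ} (α : Fin d → ℕ) (f g : (Fin d → ℝ) → ℝ) : Prop :=
  LocallyIntegrableOn f (interior (unitCube d)) ∧
  LocallyIntegrableOn g (interior (unitCube d)) ∧
  ∀ φ : (Fin d → ℝ) → ℝ, ContDiff ℝ ∞ φ → HasCompactSupport φ →
    tsupport φ ⊆ interior (unitCube d) →
    ∫ x in unitCube d, f x * multiDeriv α φ x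
      = (-1) ^ (∑ i, α i) * ∫ x in unitCube d, g x * φ x

/-- The finite set of multi-indices `α ∈ ℕ₀^d` with `|α| ≤ s`. -/
def multiIndices (d s : ℕ) : Finset (Fin d → ℕ) :=
  (Fintype.piFinset fun _ : Fin d => Finset.range (s + 1)).filter fun α => ∑ i, α i ≤ s

theorem mem_multiIndices {d s : ℕ} {α : Fin d → ℕ} :
    α ∈ multiIndices d s ↔ ∑ i, α i ≤ s := by
  simp only [multiIndices, Finset.mem_filter, Fintype.mem_piFinset, Finset.mem_range,
    and_iff_right_iff_imp]
  intro h i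
  exact Nat.lt_succ_of_le ((Finset.single_le_sum (fun _ _ => Nat.zero_le _)
    (Finset.mem_univ i)).trans h)

/-- Membership of (a representative of) `f` in the Sobolev space `W^{s,p}(Ω)`: `f ∈ L^p(Ω)`, and for
every `|α| ≤ s` the weak derivative `D^α f` exists and lies in `L^p(Ω)`. -/
def MemSobolev {d : ℕ} (s : ℕ) (p : ℝ≥0∞) (f : (Fin d → ℝ) → ℝ) : Prop :=
  MemLp f p (uniformCube d) ∧
  ∀ α : Fin d → ℕ, ∑ i, α i ≤ s → ∃ g, IsWeakDeriv α f g ∧ MemLp g p (uniformCube d)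

/-- `‖D^α f‖_{L^p(Ω)}`. Weak derivatives are unique up to null sets, so all members of the family
over which the infimum is taken have the same norm; the value is `∞` if there is no weak
derivative. -/
def weakDerivNorm {d : ℕ} (α : Fin d → ℕ) (p : ℝ≥0∞) (f : (Fin d → ℝ) → ℝ) : ℝ≥0∞ :=
  ⨅ (g : (Fin d → ℝ) → ℝ) (_ : IsWeakDeriv α f g), eLpNorm g p (uniformCube d)

/-- The Sobolev norm `∑_{|α| ≤ s} ‖D^α f‖_{L^p(Ω)}`. -/
def sobolevNorm {d : ℕ} (s : ℕ) (p : ℝ≥0∞) (f : (Fin d → ℝ) → ℝ) : ℝ≥0∞ :=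
  ∑ α ∈ multiIndices d s, weakDerivNorm α p f

/-- The closed ball of radius `R ∈ [0,∞]` around zero in `W^{s,p}(Ω)`; for `R = ∞` this is the whole
space `W^{s,p}(Ω)`. -/
def sobolevBall (d s : ℕ) (p R : ℝ≥0∞) : Set ((Fin d → ℝ) → ℝ) :=
  {f | MemSobolev s p f ∧ sobolevNorm s p f ≤ R}

/-- The `q`-th moment `I_f^q = ∫_Ω f^q`. -/
def moment {d : ℕ} (q : ℕ) (f : (Fin d → ℝ) → ℝ) : ℝ :=
  ∫ x, f x ^ q ∂(uniformCube d)

/-- The expected error `E |H((x_i), (f(x_i))) - I_f^q|`, where `x_1, …, x_n` are independent and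
uniformly distributed on the unit cube. -/
def expectedError {d n : ℕ} (q : ℕ) (H : (Fin n → Fin d → ℝ) → (Fin n → ℝ) → ℝ)
    (f : (Fin d → ℝ) → ℝ) : ℝ≥0∞ :=
  ∫⁻ x, ENNReal.ofReal |H x (fun i => f (x i)) - moment q f|
    ∂(Measure.pi fun _ : Fin n => uniformCube d)

/-- The minimax expected error over the class `F`: the infimum over all (measurable) estimators,
which see the `n` points and the `n` exact function values, of the worst-case expected error. -/
def minimaxError (d n q : ℕ) (F : Set ((Fin d → ℝ) → ℝ)) : ℝ≥0∞ :=
  ⨅ (H : (Fin n → Fin d → ℝ) → (Fin n → ℝ) → ℝ) (_ : Measurable (Function.uncurry H)),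
    ⨆ f ∈ F, expectedError q H f

end

/-! Cut the cube into `X = m ^ d` cells with `2n ≤ X ≤ 2 ^ (d + 1) * n` and put a smooth bump in
each. The bumps have disjoint supports, so `n` points meet at most `n` of them. Whatever the sample,
at least half of the bumps are unseen, and changing them does not change the data. The worst-case
error is bounded below by its average over a finite family, and two families give the two exponents.

Rare tall bump (`le_minimaxError_of_single`): the family contains zero and one bump of height `b ~
m^(-s) X^(1/p)` on any cell. The small support is what lets the Sobolev norm afford the factor
`X^(1/p)`. On an unseen cell the data vanish in both cases, while the moments differ by about `b^q /
X ~ X^(-q(s/d - 1/p) - 1)`.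

Random signs (`le_minimaxError_of_signs`): add bumps of height `b ~ m^(-s)` with arbitrary signs to
a constant `a`. Each unseen sign shifts the moment by about `a^(q-1) b / X`. By `khintchine_one` the
roughly `X` independent shifts add up to about `√X` times that on average, which is `X^(-1/2 -
s/d)`. -/

/-! ### Khintchine's inequality in `L¹` -/

/-- The sign attached to a Boolean. -/
def boolSign (b : Bool) : ℝ := if b then 1 else -1

/-- Change the values of `ε` at the points of `U`. -/
def flipOn {ι : Type*} [DecidableEq ι] (U : Finset ι) (ε : ι → Bool) : ι → Bool :=
  fun k => if k ∈ U then !ε k else ε k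

theorem boolSign_not (b : Bool) : boolSign (!b) = -boolSign b := by
  cases b <;> simp [boolSign]

theorem flipOn_involutive {ι : Type*} [DecidableEq ι] (U : Finset ι) :
    Function.Involutive (flipOn U) := by
  intro ε
  funext k
  by_cases h : k ∈ U <;> simp [flipOn, h]

theorem sum_comp_flipOn {ι : Type*} [Fintype ι] [DecidableEq ι] (U : Finset ι)
    (F : (ι → Bool) → ℝ) : ∑ ε, F (flipOn U ε) = ∑ ε, F ε :=
  Equiv.sum_comp (flipOn_involutive U).toPerm F

/-- Averaging over one sign that does not occur in the argument. -/
theorem sum_signs_insert {ι : Type*} [Fintype ι] [DecidableEq ι] (a : ι → ℝ) (F : ℝ → ℝ)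
    {j : ι} {t : Finset ι} (hj : j ∉ t) :
    ∑ ε : ι → Bool, F (∑ k ∈ insert j t, a k * boolSign (ε k)) =
      ∑ ε : ι → Bool, (F ((∑ k ∈ t, a k * boolSign (ε k)) + a j)
        + F ((∑ k ∈ t, a k * boolSign (ε k)) - a j)) / 2 := by
  have h := sum_comp_flipOn {j} (fun ε => F (∑ k ∈ insert j t, a k * boolSign (ε k)))
  have h2 : ∑ ε : ι → Bool, F (∑ k ∈ insert j t, a k * boolSign (ε k)) =
      ∑ ε : ι → Bool, (F (∑ k ∈ insert j t, a k * boolSign (ε k)) +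
        F (∑ k ∈ insert j t, a k * boolSign (flipOn {j} ε k))) / 2 := by
    rw [← Finset.sum_div, Finset.sum_add_distrib, h]
    ring
  rw [h2]
  refine Finset.sum_congr rfl fun ε _ => ?_
  have h3 : ∑ k ∈ t, a k * boolSign (flipOn {j} ε k) = ∑ k ∈ t, a k * boolSign (ε k) := by
    refine Finset.sum_congr rfl fun k hk => ?_
    have : k ≠ j := fun e => hj (e ▸ hk)
    simp [flipOn, this]
  rw [Finset.sum_insert hj, Finset.sum_insert hj, h3]
  have h4 : boolSign (flipOn {j} ε j) = -boolSign (ε j) := by simp [flipOn, boolSign_not]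
  rw [h4]
  generalize ∑ k ∈ t, a k * boolSign (ε k) = S
  cases ε j <;> simp [boolSign, add_comm, sub_eq_add_neg]

theorem sum_signs_sq {ι : Type*} [Fintype ι] [DecidableEq ι] (a : ι → ℝ) (t : Finset ι) :
    ∑ ε : ι → Bool, (∑ k ∈ t, a k * boolSign (ε k)) ^ 2
      = 2 ^ Fintype.card ι * ∑ k ∈ t, a k ^ 2 := by
  induction t using Finset.induction_on with
  | empty => simp
  | insert j t hj ih =>
    rw [sum_signs_insert a (· ^ 2) hj, Finset.sum_insert hj, mul_add, ← ih]
    have : ∀ S : ℝ, ((S + a j) ^ 2 + (S - a j) ^ 2) / 2 = a j ^ 2 + S ^ 2 := fun S => by ring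
    simp only [this, Finset.sum_add_distrib]
    simp

/-- Adding one sign creates the mixed term `6 a_j² S²`, whose average is exactly the cross term of
`3 (∑ a_k² + a_j²)²`; the remaining `a_j⁴` is below `3 a_j⁴`. -/
theorem sum_signs_pow_four_le {ι : Type*} [Fintype ι] [DecidableEq ι] (a : ι → ℝ)
    (t : Finset ι) :
    ∑ ε : ι → Bool, (∑ k ∈ t, a k * boolSign (ε k)) ^ 4
      ≤ 3 * 2 ^ Fintype.card ι * (∑ k ∈ t, a k ^ 2) ^ 2 := by
  induction t using Finset.induction_on with
  | empty => simp
  | insert j t hj ih =>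
    rw [sum_signs_insert a (· ^ 4) hj, Finset.sum_insert hj]
    have h1 : ∀ S : ℝ, ((S + a j) ^ 4 + (S - a j) ^ 4) / 2
        = S ^ 4 + 6 * a j ^ 2 * S ^ 2 + a j ^ 4 := fun S => by ring
    simp only [h1, Finset.sum_add_distrib, ← Finset.mul_sum, sum_signs_sq]
    have h2 : ∑ _ε : ι → Bool, a j ^ 4 = 2 ^ Fintype.card ι * a j ^ 4 := by simp
    rw [h2]
    have h3 : 0 ≤ (2 : ℝ) ^ Fintype.card ι * a j ^ 4 := by positivity
    nlinarith [ih, h3]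

/-- Khintchine's inequality: the mean of `|∑ ±a_k|` is at least `(∑ a_k²)^{1/2} / 8`. -/
theorem khintchine_one {ι : Type*} [Fintype ι] [DecidableEq ι] (a : ι → ℝ) (t : Finset ι) :
    2 ^ Fintype.card ι * (√(∑ k ∈ t, a k ^ 2) / 8)
      ≤ ∑ ε : ι → Bool, |∑ k ∈ t, a k * boolSign (ε k)| := by
  set σ := √(∑ k ∈ t, a k ^ 2) with hσ
  have hσ2 : σ ^ 2 = ∑ k ∈ t, a k ^ 2 :=
    Real.sq_sqrt (Finset.sum_nonneg fun k _ => sq_nonneg (a k))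
  rcases (Real.sqrt_nonneg _ : 0 ≤ σ).eq_or_lt with h0 | h0
  · rw [show σ = 0 from h0.symm]
    simpa using Finset.sum_nonneg fun ε _ => abs_nonneg _
  -- A minorant of `|S|` by even moments: the second moment `σ²` and the fourth, at most `3σ⁴`,
  -- leave `σ/2 - 3σ/8 = σ/8`.
  have hpt : ∀ S : ℝ, S ^ 2 / (2 * σ) - S ^ 4 / (8 * σ ^ 3) ≤ |S| := by
    intro S
    have key : 4 * σ ^ 2 * |S| ^ 2 - |S| ^ 4 ≤ 8 * σ ^ 3 * |S| := by
      have hS := abs_nonneg S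
      rcases le_total |S| (2 * σ) with h | h
      · nlinarith [mul_nonneg (mul_nonneg hS (sq_nonneg σ)) (sub_nonneg.2 h), pow_nonneg hS 4]
      · have : 0 ≤ |S| ^ 2 * (|S| ^ 2 - 4 * σ ^ 2) :=
          mul_nonneg (sq_nonneg _) (by nlinarith)
        nlinarith [mul_nonneg (pow_pos h0 3).le hS]
    have e : S ^ 2 / (2 * σ) - S ^ 4 / (8 * σ ^ 3)
        = (4 * σ ^ 2 * |S| ^ 2 - |S| ^ 4) / (8 * σ ^ 3) := by
      rw [sq_abs, show |S| ^ 4 = S ^ 4 from Even.pow_abs ⟨2, rfl⟩ S]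
      field_simp
      ring
    rw [e, div_le_iff₀ (by positivity)]
    linarith
  refine le_trans ?_ (Finset.sum_le_sum fun ε _ => hpt _)
  rw [Finset.sum_sub_distrib, ← Finset.sum_div, ← Finset.sum_div, sum_signs_sq, ← hσ2]
  have h4 := sum_signs_pow_four_le a t
  rw [← hσ2] at h4
  have h5 := div_le_div_of_nonneg_right h4 (by positivity : 0 ≤ 8 * σ ^ 3)
  have e1 : 3 * 2 ^ Fintype.card ι * (σ ^ 2) ^ 2 / (8 * σ ^ 3)
      = 2 ^ Fintype.card ι * (3 * σ / 8) := by
    field_simp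
  have e2 : 2 ^ Fintype.card ι * σ ^ 2 / (2 * σ) = 2 ^ Fintype.card ι * (σ / 2) := by
    field_simp
  rw [e2]
  rw [e1] at h5
  linarith

/-! ### Averaging over finitely many functions -/

/-- A supremum dominates an average. The hypothesis is asked for each fixed sample, so the estimator
becomes an arbitrary function of the data alone; measurability serves only to exchange the finite
sum and the integral. -/
theorem le_minimaxError_of_average {d n q : ℕ} {F : Set ((Fin d → ℝ) → ℝ)} {ι : Type*}
    [Fintype ι] [Nonempty ι] (f : ι → (Fin d → ℝ) → ℝ) (hf : ∀ i, f i ∈ F)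
    (hm : ∀ i, Measurable (f i)) (L : ℝ)
    (h : ∀ (H : (Fin n → ℝ) → ℝ) (x : Fin n → Fin d → ℝ),
      Fintype.card ι * L ≤ ∑ i, |H (fun j => f i (x j)) - moment q (f i)|) :
    ENNReal.ofReal L ≤ minimaxError d n q F := by
  refine le_iInf₂ fun H hH => ?_
  set B := ⨆ g ∈ F, expectedError q H g
  have hmeas : ∀ i, Measurable fun x : Fin n → Fin d → ℝ =>
      ENNReal.ofReal |H x (fun j => f i (x j)) - moment q (f i)| := by
    intro i
    have h1 : Measurable fun x : Fin n → Fin d → ℝ => H x (fun j => f i (x j)) :=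
      hH.comp (measurable_id.prodMk
        (measurable_pi_lambda _ fun j => (hm i).comp (measurable_pi_apply j)))
    exact ENNReal.measurable_ofReal.comp (h1.sub_const _).norm
  have h1 : ∑ i, expectedError q H (f i) ≤ Fintype.card ι * B := by
    refine (Finset.sum_le_sum fun i _ => ?_).trans (b := ∑ _i : ι, B) (by simp)
    exact le_iSup₂_of_le (f i) (hf i) le_rfl
  have h2 : ENNReal.ofReal (Fintype.card ι * L) ≤ ∑ i, expectedError q H (f i) := by
    unfold expectedError
    rw [← lintegral_finsetSum _ fun i _ => hmeas i]
    calc ENNReal.ofReal (Fintype.card ι * L)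
        = ∫⁻ _x, ENNReal.ofReal (Fintype.card ι * L)
            ∂(Measure.pi fun _ : Fin n => uniformCube d) := by simp
      _ ≤ _ := by
        refine lintegral_mono fun x => ?_
        rw [← ENNReal.ofReal_sum_of_nonneg fun i _ => abs_nonneg _]
        exact ENNReal.ofReal_le_ofReal (h (H x) x)
  have h3 := h2.trans h1
  rw [ENNReal.ofReal_mul (by positivity), ENNReal.ofReal_natCast] at h3
  exact (ENNReal.mul_le_mul_iff_right (by simp) (by simp)).1 h3

/-! ### Iterated partial derivatives of smooth functions -/

/-- The iterated partial derivative along a list of directions; the head of the list acts last. -/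
noncomputable def listDeriv {d : ℕ} (l : List (Fin d)) (f : (Fin d → ℝ) → ℝ) : (Fin d → ℝ) → ℝ :=
  l.foldr partialDeriv f

/-- The list in which each direction `i` occurs `α i` times. -/
def multiList {d : ℕ} (α : Fin d → ℕ) : List (Fin d) :=
  (List.finRange d).flatMap fun i => List.replicate (α i) i

theorem length_multiList {d : ℕ} (α : Fin d → ℕ) : (multiList α).length = ∑ i, α i := by
  simp [multiList, List.length_flatMap, Fin.sum_univ_def]

theorem foldr_replicate_partialDeriv {d : ℕ} (k : ℕ) (i : Fin d) (f : (Fin d → ℝ) → ℝ) :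
    (List.replicate k i).foldr partialDeriv f = (partialDeriv i)^[k] f := by
  induction k with
  | zero => rfl
  | succ k ih => rw [List.replicate_succ, List.foldr_cons, ih, Function.iterate_succ_apply']

theorem multiDeriv_eq_listDeriv {d : ℕ} (α : Fin d → ℕ) (f : (Fin d → ℝ) → ℝ) :
    multiDeriv α f = listDeriv (multiList α) f := by
  unfold multiDeriv listDeriv multiList
  induction List.finRange d with
  | nil => rfl
  | cons i l ih =>
    rw [List.flatMap_cons, List.foldr_append, List.foldr_cons, ih, foldr_replicate_partialDeriv]

theorem ContDiff.partialDeriv {d : ℕ} {f : (Fin d → ℝ) → ℝ} (hf : ContDiff ℝ ∞ f) (i : Fin d) :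
    ContDiff ℝ ∞ (partialDeriv i f) :=
  (hf.fderiv_right (m := ∞) (by simp)).clm_apply contDiff_const

theorem ContDiff.listDeriv {d : ℕ} {f : (Fin d → ℝ) → ℝ} (hf : ContDiff ℝ ∞ f)
    (l : List (Fin d)) : ContDiff ℝ ∞ (listDeriv l f) := by
  induction l with
  | nil => exact hf
  | cons i l ih => exact ih.partialDeriv i

theorem tsupport_listDeriv_subset {d : ℕ} (f : (Fin d → ℝ) → ℝ) (l : List (Fin d)) :
    tsupport (listDeriv l f) ⊆ tsupport f := by
  induction l with
  | nil => exact subset_rfl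
  | cons i l ih => exact (tsupport_fderiv_apply_subset ℝ _).trans ih

theorem listDeriv_const_add {d : ℕ} (a : ℝ) (f : (Fin d → ℝ) → ℝ) (l : List (Fin d)) :
    ∃ a' : ℝ, |a'| ≤ |a| ∧ listDeriv l (fun x => a + f x) = fun x => a' + listDeriv l f x := by
  induction l with
  | nil => exact ⟨a, le_rfl, rfl⟩
  | cons i l ih =>
    obtain ⟨a', -, h⟩ := ih
    refine ⟨0, by simp, ?_⟩
    change partialDeriv i (listDeriv l _) = _
    rw [h]
    funext x
    simp [partialDeriv, listDeriv, fderiv_const_add]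

theorem listDeriv_sum {d : ℕ} {ι : Type*} (t : Finset ι) (θ : ι → ℝ)
    (g : ι → (Fin d → ℝ) → ℝ) (hg : ∀ k, ContDiff ℝ ∞ (g k)) (l : List (Fin d)) :
    listDeriv l (fun x => ∑ k ∈ t, θ k * g k x) = fun x => ∑ k ∈ t, θ k * listDeriv l (g k) x := by
  induction l with
  | nil => rfl
  | cons i l ih =>
    change partialDeriv i (listDeriv l _) = _
    rw [ih]
    funext x
    have hd : ∀ k, DifferentiableAt ℝ (listDeriv l (g k)) x := fun k =>
      ((hg k).listDeriv l).differentiable (by simp) x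
    simp only [partialDeriv]
    rw [fderiv_fun_sum fun k _ => (hd k).const_mul _, sum_apply]
    refine Finset.sum_congr rfl fun k _ => ?_
    rw [fderiv_const_mul (hd k)]
    rfl

theorem listDeriv_comp_affine {d : ℕ} {f : (Fin d → ℝ) → ℝ} (hf : ContDiff ℝ ∞ f) (m : ℝ)
    (v : Fin d → ℝ) (l : List (Fin d)) :
    listDeriv l (fun x => f (m • x - v)) = fun x => m ^ l.length * listDeriv l f (m • x - v) := by
  induction l with
  | nil => simp [listDeriv]
  | cons i l ih =>
    change partialDeriv i (listDeriv l _) = _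
    rw [ih]
    funext x
    have hd : DifferentiableAt ℝ (listDeriv l f) (m • x - v) :=
      (hf.listDeriv l).differentiable (by simp) _
    have h1 : HasFDerivAt (fun x : Fin d → ℝ => m • x - v)
        (m • ContinuousLinearMap.id ℝ (Fin d → ℝ)) x :=
      ((hasFDerivAt_id x).const_smul m).sub_const v
    have h2 := (hd.hasFDerivAt.comp x h1).const_mul (m ^ l.length)
    simp only [partialDeriv]
    rw [HasFDerivAt.fderiv (f := fun x => m ^ l.length * listDeriv l f (m • x - v)) h2]
    simp [listDeriv, partialDeriv, pow_succ, mul_assoc]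

theorem integral_mul_partialDeriv {d : ℕ} {f φ : (Fin d → ℝ) → ℝ} (hf : ContDiff ℝ ∞ f)
    (hφ : ContDiff ℝ ∞ φ) (hc : HasCompactSupport φ) (i : Fin d) :
    ∫ x, f x * partialDeriv i φ x = -∫ x, partialDeriv i f x * φ x := by
  have hc' : HasCompactSupport (partialDeriv i φ) := hc.fderiv_apply ℝ _
  refine integral_mul_fderiv_eq_neg_fderiv_mul_of_integrable ?_ ?_ ?_
    (fun x _ => hf.differentiable (by simp) x) (fun x _ => hφ.differentiable (by simp) x)
  · exact ((hf.partialDeriv i).continuous.mul hφ.continuous).integrable_of_hasCompactSupport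
      hc.mul_left
  · exact (hf.continuous.mul (hφ.partialDeriv i).continuous).integrable_of_hasCompactSupport
      hc'.mul_left
  · exact (hf.continuous.mul hφ.continuous).integrable_of_hasCompactSupport hc.mul_left

/-- Each integration by parts takes the outermost derivative off `φ` and makes it the innermost so
far on `f`. Keeping the reversed list avoids any appeal to the symmetry of mixed derivatives. -/
theorem integral_mul_listDeriv {d : ℕ} {φ : (Fin d → ℝ) → ℝ}
    (hφ : ContDiff ℝ ∞ φ) (hc : HasCompactSupport φ) (l : List (Fin d)) :
    ∀ {f : (Fin d → ℝ) → ℝ}, ContDiff ℝ ∞ f →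
    ∫ x, f x * listDeriv l φ x = (-1) ^ l.length * ∫ x, listDeriv l.reverse f x * φ x := by
  induction l with
  | nil => intro f _; simp [listDeriv]
  | cons i l ih =>
    intro f hf
    have hc' : HasCompactSupport (listDeriv l φ) :=
      hc.of_isClosed_subset (isClosed_tsupport _) (tsupport_listDeriv_subset φ l)
    have h := integral_mul_partialDeriv hf (hφ.listDeriv l) hc' i
    change ∫ x, f x * partialDeriv i (listDeriv l φ) x = _
    rw [h, ih (hf.partialDeriv i)]
    have e : listDeriv (i :: l).reverse f = listDeriv l.reverse (partialDeriv i f) := by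
      simp [listDeriv]
    rw [e, List.length_cons, pow_succ]
    ring

/-- A smooth function has its classical derivatives as weak derivatives. -/
theorem isWeakDeriv_of_contDiff {d : ℕ} {f : (Fin d → ℝ) → ℝ} (hf : ContDiff ℝ ∞ f)
    (α : Fin d → ℕ) : IsWeakDeriv α f (listDeriv (multiList α).reverse f) := by
  refine ⟨hf.continuous.locallyIntegrable.locallyIntegrableOn _,
    (hf.listDeriv _).continuous.locallyIntegrable.locallyIntegrableOn _, ?_⟩
  intro φ hφ hc hs
  have hz : ∀ x, x ∉ unitCube d → φ x = 0 := fun x hx =>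
    image_eq_zero_of_notMem_tsupport fun h => hx (interior_subset (hs h))
  have hz' : ∀ x, x ∉ unitCube d → listDeriv (multiList α) φ x = 0 := fun x hx =>
    image_eq_zero_of_notMem_tsupport fun h =>
      hx (interior_subset (hs (tsupport_listDeriv_subset _ _ h)))
  rw [multiDeriv_eq_listDeriv,
    setIntegral_eq_integral_of_forall_compl_eq_zero fun x hx => by rw [hz' x hx, mul_zero],
    setIntegral_eq_integral_of_forall_compl_eq_zero fun x hx => by rw [hz x hx, mul_zero],
    integral_mul_listDeriv hφ hc _ hf, length_multiList]

/-- A smooth function lies in a Sobolev ball as soon as its classical derivatives are small. -/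
theorem mem_sobolevBall_of_contDiff {d s : ℕ} {p R : ℝ≥0∞} {f : (Fin d → ℝ) → ℝ}
    (hf : ContDiff ℝ ∞ f) (K : (Fin d → ℕ) → ℝ)
    (hK : ∀ α : Fin d → ℕ, ∑ i, α i ≤ s →
      eLpNorm (listDeriv (multiList α).reverse f) p (uniformCube d) ≤ ENNReal.ofReal (K α))
    (hR : ∑ α ∈ multiIndices d s, ENNReal.ofReal (K α) ≤ R) : f ∈ sobolevBall d s p R := by
  have hmem : ∀ α : Fin d → ℕ, ∑ i, α i ≤ s →
      MemLp (listDeriv (multiList α).reverse f) p (uniformCube d) := fun α hα =>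
    ⟨(hf.listDeriv _).continuous.aestronglyMeasurable, (hK α hα).trans_lt ENNReal.ofReal_lt_top⟩
  refine ⟨⟨?_, fun α hα => ⟨_, isWeakDeriv_of_contDiff hf α, hmem α hα⟩⟩, le_trans ?_ hR⟩
  · have h := hmem 0 (by simp)
    have e : multiList (0 : Fin d → ℕ) = [] := by
      rw [← List.length_eq_zero_iff, length_multiList]; simp
    rw [e] at h
    exact h
  · exact Finset.sum_le_sum fun α hα =>
      (iInf₂_le _ (isWeakDeriv_of_contDiff hf α)).trans (hK α (mem_multiIndices.1 hα))

theorem eLpNorm_le_of_support_subset {X : Type*} [MeasurableSpace X] {μ : Measure X} {p : ℝ≥0∞}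
    {f : X → ℝ} {S : Set X} {C : ℝ} (hS : Function.support f ⊆ S) (hC : ∀ x, |f x| ≤ C) :
    eLpNorm f p μ ≤ μ S ^ p.toReal⁻¹ * ENNReal.ofReal C := by
  rw [← eLpNorm_restrict_eq_of_support_subset hS]
  exact (eLpNorm_le_of_ae_bound (.of_forall hC)).trans (by simp)

/-! ### Bumps on the cells of a grid -/

/-- A smooth bump supported in `[-1/3,1/3]^d` and equal to one on `[-1/4,1/4]^d`. -/
noncomputable def cubeBump (d : ℕ) : ContDiffBump (0 : Fin d → ℝ) :=
  ⟨1 / 4, 1 / 3, by norm_num, by norm_num⟩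

/-- The bump `cubeBump d` rescaled to the cell with index `k` of the grid of mesh `1/m`. -/
noncomputable def cellBump {d m : ℕ} (k : Fin d → Fin m) (x : Fin d → ℝ) : ℝ :=
  cubeBump d ((m : ℝ) • x - fun i => (k i : ℝ) + 1 / 2)

/-- A constant plus a linear combination of the bumps on all cells. -/
noncomputable def bumpSum {d m : ℕ} (a : ℝ) (θ : (Fin d → Fin m) → ℝ) (x : Fin d → ℝ) : ℝ :=
  a + ∑ k, θ k * cellBump k x

theorem contDiff_cellBump {d m : ℕ} (k : Fin d → Fin m) : ContDiff ℝ ∞ (cellBump k) :=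
  (cubeBump d).contDiff.comp ((contDiff_const_smul _).sub contDiff_const)

theorem cellBump_nonneg {d m : ℕ} (k : Fin d → Fin m) (x : Fin d → ℝ) : 0 ≤ cellBump k x :=
  (cubeBump d).nonneg

theorem cellBump_le_one {d m : ℕ} (k : Fin d → Fin m) (x : Fin d → ℝ) : cellBump k x ≤ 1 :=
  (cubeBump d).le_one

theorem contDiff_bumpSum {d m : ℕ} (a : ℝ) (θ : (Fin d → Fin m) → ℝ) :
    ContDiff ℝ ∞ (bumpSum a θ) :=
  contDiff_const.add (ContDiff.sum fun k _ => contDiff_const.mul (contDiff_cellBump k))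

theorem listDeriv_cellBump {d m : ℕ} (l : List (Fin d)) (k : Fin d → Fin m) (x : Fin d → ℝ) :
    listDeriv l (cellBump k) x =
      (m : ℝ) ^ l.length *
        listDeriv l (cubeBump d) ((m : ℝ) • x - fun i => (k i : ℝ) + 1 / 2) :=
  congrFun (listDeriv_comp_affine (cubeBump d).contDiff (m : ℝ) _ l) x

theorem abs_sub_le_of_listDeriv_cellBump_ne_zero {d m : ℕ} {l : List (Fin d)}
    {k : Fin d → Fin m} {x : Fin d → ℝ} (h : listDeriv l (cellBump k) x ≠ 0) (i : Fin d) :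
    |m * x i - ((k i : ℝ) + 1 / 2)| ≤ 1 / 3 := by
  rw [listDeriv_cellBump] at h
  have h1 := tsupport_listDeriv_subset _ _ (subset_tsupport _ (right_ne_zero_of_mul h))
  rw [(cubeBump d).tsupport_eq, mem_closedBall_zero_iff] at h1
  exact (norm_le_pi_norm _ i).trans h1

/-- The supports of bumps on different cells are disjoint. -/
theorem eq_of_listDeriv_cellBump_ne_zero {d m : ℕ} {l : List (Fin d)}
    {k k' : Fin d → Fin m} {x : Fin d → ℝ} (h : listDeriv l (cellBump k) x ≠ 0)
    (h' : listDeriv l (cellBump k') x ≠ 0) : k = k' := by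
  funext i
  have h1 := abs_le.1 (abs_sub_le_of_listDeriv_cellBump_ne_zero h i)
  have h2 := abs_le.1 (abs_sub_le_of_listDeriv_cellBump_ne_zero h' i)
  -- Two centres within `1/3` of the same point differ by at most `2/3 < 1`, so the integer indices
  -- agree.
  have h3 : ((k i : ℕ) : ℝ) < (k' i : ℕ) + 1 := by linarith
  have h4 : ((k' i : ℕ) : ℝ) < (k i : ℕ) + 1 := by linarith
  norm_cast at h3 h4
  exact Fin.ext (by omega)

theorem eq_of_cellBump_ne_zero {d m : ℕ} {k k' : Fin d → Fin m} {x : Fin d → ℝ}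
    (h : cellBump k x ≠ 0) (h' : cellBump k' x ≠ 0) : k = k' :=
  eq_of_listDeriv_cellBump_ne_zero (l := []) h h'

/-- A sum with at most one nonzero term. -/
theorem sum_eq_zero_or_exists {ι : Type*} [Fintype ι] (θ g : ι → ℝ)
    (hg : ∀ k k', g k ≠ 0 → g k' ≠ 0 → k = k') :
    (∀ k, g k = 0) ∨ ∃ k, (∀ k', k' ≠ k → g k' = 0) ∧ ∑ j, θ j * g j = θ k * g k := by
  by_cases h : ∀ k, g k = 0
  · exact Or.inl h
  · push Not at h
    obtain ⟨k, hk⟩ := h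
    have h0 : ∀ k', k' ≠ k → g k' = 0 := fun k' hne => by
      by_contra hk'
      exact hne (hg _ _ hk' hk)
    exact Or.inr ⟨k, h0, Fintype.sum_eq_single k fun j hj => by rw [h0 j hj, mul_zero]⟩

theorem exists_bound_listDeriv_cubeBump {d : ℕ} (l : List (Fin d)) :
    ∃ C : ℝ, 0 ≤ C ∧ ∀ y, |listDeriv l (cubeBump d) y| ≤ C := by
  have hc : HasCompactSupport (listDeriv l (cubeBump d)) :=
    (cubeBump d).hasCompactSupport.of_isClosed_subset (isClosed_tsupport _)
      (tsupport_listDeriv_subset _ l)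
  obtain ⟨C, hC⟩ := hc.exists_bound_of_continuous
    ((cubeBump d).contDiff.listDeriv l).continuous
  exact ⟨C, (norm_nonneg _).trans (hC 0), hC⟩

/-- At most one bump contributes at `x`, hence no factor counting the cells; rescaling costs one `m`
per derivative. -/
theorem abs_listDeriv_bumpSum_le {d m : ℕ} {a b C : ℝ} {θ : (Fin d → Fin m) → ℝ} (hb : 0 ≤ b)
    (hθ : ∀ k, |θ k| ≤ b) {l : List (Fin d)} (hC : ∀ y, |listDeriv l (cubeBump d) y| ≤ C)
    (x : Fin d → ℝ) : |listDeriv l (bumpSum a θ) x| ≤ |a| + b * (m : ℝ) ^ l.length * C := by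
  have hC0 : 0 ≤ C := (abs_nonneg _).trans (hC 0)
  obtain ⟨a', ha', h⟩ := listDeriv_const_add a (fun x => ∑ k, θ k * cellBump k x) l
  change |listDeriv l (fun x => a + ∑ k, θ k * cellBump k x) x| ≤ _
  rw [h, listDeriv_sum _ _ _ contDiff_cellBump]
  refine (abs_add_le _ _).trans (add_le_add ha' ?_)
  beta_reduce
  rcases sum_eq_zero_or_exists θ (fun k => listDeriv l (cellBump k) x)
    fun _ _ => eq_of_listDeriv_cellBump_ne_zero with h0 | ⟨k, -, h1⟩
  · rw [Finset.sum_eq_zero fun k _ => by rw [h0 k, mul_zero], abs_zero]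
    positivity
  · simp only [h1]
    rw [abs_mul, listDeriv_cellBump, abs_mul,
      abs_of_nonneg (a := (m : ℝ) ^ l.length) (by positivity), mul_assoc]
    exact mul_le_mul (hθ k) (mul_le_mul_of_nonneg_left (hC _) (by positivity)) (by positivity) hb

theorem support_listDeriv_cellBump_subset {d m : ℕ} (hm : 0 < m) (l : List (Fin d))
    (k : Fin d → Fin m) : Function.support (listDeriv l (cellBump k)) ⊆
      Metric.closedBall (fun i => ((k i : ℝ) + 1 / 2) / m) (1 / (2 * m)) := by
  intro x hx
  have hm' : (0 : ℝ) < m := by exact_mod_cast hm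
  rw [Metric.mem_closedBall, dist_pi_le_iff (by positivity)]
  intro i
  have h := abs_sub_le_of_listDeriv_cellBump_ne_zero hx i
  rw [Real.dist_eq, show x i - ((k i : ℝ) + 1 / 2) / m = (m * x i - ((k i : ℝ) + 1 / 2)) / m by
    field_simp, abs_div, abs_of_pos hm', div_le_div_iff₀ hm' (by positivity)]
  nlinarith

/-- The sample points leave at least `m ^ d - n` cells unseen. -/
theorem card_le_card_unseen_add {d m n : ℕ} (x : Fin n → Fin d → ℝ) (U : Finset (Fin d → Fin m))
    (hU : ∀ k, k ∉ U → ∃ j, cellBump k (x j) ≠ 0) : m ^ d ≤ U.card + n := by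
  classical
  -- Assign to each seen cell a sample point seeing it; disjoint supports make this injective.
  choose g hg using hU
  have h1 : Fintype.card ↥Uᶜ ≤ Fintype.card (Fin n) := by
    refine Fintype.card_le_of_injective (fun k => g k.1 (Finset.mem_compl.1 k.2)) ?_
    intro k k' e
    have h := hg k'.1 (Finset.mem_compl.1 k'.2)
    rw [← show g k.1 _ = g k'.1 _ from e] at h
    exact Subtype.ext (eq_of_cellBump_ne_zero (hg k.1 (Finset.mem_compl.1 k.2)) h)
  rw [Fintype.card_coe] at h1
  have h2 := Finset.card_add_card_compl U
  simp only [Fintype.card_pi, Fintype.card_fin, Finset.prod_const, Finset.card_univ] at h1 h2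
  omega

/-! ### Moments of sums of bumps -/

theorem integrable_uniformCube {d : ℕ} {f : (Fin d → ℝ) → ℝ} (hf : Continuous f) :
    Integrable f (uniformCube d) :=
  hf.continuousOn.integrableOn_compact isCompact_Icc

theorem continuous_cellBump {d m : ℕ} (k : Fin d → Fin m) : Continuous (cellBump k) :=
  (contDiff_cellBump k).continuous

/-- The contribution of one cell to the moment of a sum of bumps. -/
noncomputable def cellMoment {d m : ℕ} (q : ℕ) (a t : ℝ) (k : Fin d → Fin m) : ℝ :=
  ∫ x, ((a + t * cellBump k x) ^ q - a ^ q) ∂(uniformCube d)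

/-- Since at most one bump is nonzero at each point, even the nonlinear power splits as a sum over
cells. -/
theorem moment_bumpSum {d m : ℕ} (q : ℕ) (a : ℝ) (θ : (Fin d → Fin m) → ℝ) :
    moment q (bumpSum a θ) = a ^ q + ∑ k, cellMoment q a (θ k) k := by
  have h : ∀ x, bumpSum a θ x ^ q = a ^ q + ∑ k, ((a + θ k * cellBump k x) ^ q - a ^ q) := by
    intro x
    rcases sum_eq_zero_or_exists θ (fun k => cellBump k x) fun _ _ => eq_of_cellBump_ne_zero
      with h0 | ⟨k, h0, h1⟩
    · simp [bumpSum, h0]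
    · rw [Fintype.sum_eq_single k fun j hj => by rw [h0 j hj]; simp, bumpSum, h1]
      ring
  have hc : ∀ k, Integrable (fun x => (a + θ k * cellBump k x) ^ q - a ^ q) (uniformCube d) :=
    fun k => integrable_uniformCube (by have := continuous_cellBump k; fun_prop)
  unfold moment cellMoment
  simp only [h]
  rw [integral_add (integrable_const _) (integrable_finsetSum _ fun k _ => hc k),
    integral_finsetSum _ fun k _ => hc k]
  simp

/-- The bump is one on a cube of side `1/(2m)` inside the unit cube. -/
theorem le_integral_cellBump_pow {d m : ℕ} (hm : 0 < m) (k : Fin d → Fin m) (q : ℕ) :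
    1 / 2 ^ d / (m : ℝ) ^ d ≤ ∫ x, cellBump k x ^ q ∂(uniformCube d) := by
  have hm' : (0 : ℝ) < m := by exact_mod_cast hm
  set S := Metric.closedBall (fun i => ((k i : ℝ) + 1 / 2) / m) (1 / (4 * (m : ℝ))) with hS
  have hcoord : ∀ x ∈ S, ∀ i, |m * x i - ((k i : ℝ) + 1 / 2)| ≤ 1 / 4 := by
    intro x hx i
    have h := (dist_le_pi_dist x _ i).trans hx
    rw [Real.dist_eq, show x i - ((k i : ℝ) + 1 / 2) / m = (m * x i - ((k i : ℝ) + 1 / 2)) / m by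
      field_simp, abs_div, abs_of_pos hm', div_le_div_iff₀ hm' (by positivity)] at h
    nlinarith
  have hone : ∀ x ∈ S, cellBump k x = 1 := by
    intro x hx
    refine (cubeBump d).one_of_mem_closedBall ?_
    rw [mem_closedBall_zero_iff]
    exact (pi_norm_le_iff_of_nonneg (by norm_num [cubeBump])).2 fun i => hcoord x hx i
  have hsub : S ⊆ unitCube d := by
    intro x hx
    rw [unitCube, Set.mem_Icc]
    have hk : ∀ i, ((k i : ℕ) : ℝ) + 1 ≤ m := fun i => by exact_mod_cast (k i).2
    refine ⟨fun i => ?_, fun i => ?_⟩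
    · have h := (abs_le.1 (hcoord x hx i)).1
      have h0 : (0 : ℝ) ≤ (k i : ℕ) := by positivity
      exact le_of_mul_le_mul_left (by simp; linarith) hm'
    · have h := (abs_le.1 (hcoord x hx i)).2
      have h0 := hk i
      exact le_of_mul_le_mul_left (by simp; linarith) hm'
  have hvol : (uniformCube d).real S = 1 / 2 ^ d / (m : ℝ) ^ d := by
    rw [uniformCube, Measure.real, Measure.restrict_eq_self _ hsub,
      Real.volume_pi_closedBall _ (by positivity), ENNReal.toReal_ofReal (by positivity),
      Fintype.card_fin, show 2 * (1 / (4 * (m : ℝ))) = 1 / 2 / m by field_simp; norm_num,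
      div_pow, div_pow, one_pow]
  have hc : Continuous fun x => cellBump k x ^ q := (continuous_cellBump k).pow q
  calc 1 / 2 ^ d / (m : ℝ) ^ d = ∫ x in S, cellBump k x ^ q ∂(uniformCube d) := by
        rw [setIntegral_congr_fun (g := fun _ => (1 : ℝ)) Metric.isClosed_closedBall.measurableSet
          fun x hx => by simp [hone x hx], setIntegral_const, hvol]
        simp
    _ ≤ _ := setIntegral_le_integral (integrable_uniformCube hc)
        (.of_forall fun x => pow_nonneg (cellBump_nonneg k x) q)

theorem le_cellMoment_zero {d m q : ℕ} (hm : 0 < m) (hq : q ≠ 0) {b : ℝ} (hb : 0 ≤ b)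
    (k : Fin d → Fin m) : b ^ q * (1 / 2 ^ d / (m : ℝ) ^ d) ≤ cellMoment q 0 b k := by
  have e : cellMoment q 0 b k = b ^ q * ∫ x, cellBump k x ^ q ∂(uniformCube d) := by
    rw [← integral_const_mul]
    simp [cellMoment, mul_pow, hq]
  rw [e]
  exact mul_le_mul_of_nonneg_left (le_integral_cellBump_pow hm k q) (by positivity)

/-- Integrate `(a + u)^q - (a - u)^q ≥ 2 a^(q-1) u`, valid for `0 ≤ u ≤ a`, with `u` the bump of
height `b`. -/
theorem le_cellMoment_sub {d m q : ℕ} (hm : 0 < m) (hq : q ≠ 0) {a b : ℝ} (hb : 0 ≤ b)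
    (hab : b ≤ a) (k : Fin d → Fin m) :
    2 * a ^ (q - 1) * b * (1 / 2 ^ d / (m : ℝ) ^ d)
      ≤ cellMoment q a b k - cellMoment q a (-b) k := by
  have hc := continuous_cellBump k
  have ha : 0 ≤ a := hb.trans hab
  obtain ⟨r, rfl⟩ := Nat.exists_eq_succ_of_ne_zero hq
  unfold cellMoment
  rw [← integral_sub (integrable_uniformCube (by fun_prop)) (integrable_uniformCube (by fun_prop))]
  refine (mul_le_mul_of_nonneg_left (le_integral_cellBump_pow hm k 1) (by positivity)).trans ?_
  rw [← integral_const_mul]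
  refine integral_mono (integrable_uniformCube (by fun_prop))
    (integrable_uniformCube (by fun_prop)) fun x => ?_
  have h0 : 0 ≤ b * cellBump k x := mul_nonneg hb (cellBump_nonneg k x)
  have h1 : b * cellBump k x ≤ a := (mul_le_of_le_one_right hb (cellBump_le_one k x)).trans hab
  simp only [Nat.succ_eq_add_one, Nat.add_sub_cancel, neg_mul, ← sub_eq_add_neg, pow_one, mul_assoc]
  generalize b * cellBump k x = u at h0 h1
  have h2 : (a + u) * a ^ r ≤ (a + u) ^ (r + 1) := by
    rw [pow_succ']
    exact mul_le_mul_of_nonneg_left (pow_le_pow_left₀ ha (by linarith) r) (by linarith)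
  have h3 : (a - u) ^ (r + 1) ≤ (a - u) * a ^ r := by
    rw [pow_succ']
    exact mul_le_mul_of_nonneg_left (pow_le_pow_left₀ (by linarith) (by linarith) r) (by linarith)
  nlinarith

/-! ### Lower bounds from single bumps and from random signs -/

theorem exists_unseen {d m n : ℕ} (hmn : 2 * n ≤ m ^ d) (x : Fin n → Fin d → ℝ) :
    ∃ U : Finset (Fin d → Fin m), (∀ k ∈ U, ∀ j, cellBump k (x j) = 0) ∧
      (m : ℝ) ^ d / 2 ≤ U.card := by
  classical
  set U : Finset (Fin d → Fin m) := Finset.univ.filter fun k => ∀ j, cellBump k (x j) = 0 with hU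
  refine ⟨U, fun k hk => (Finset.mem_filter.1 hk).2, ?_⟩
  have h := card_le_card_unseen_add x U fun k hk => by simpa [hU] using hk
  have h2 : m ^ d ≤ U.card * 2 := by omega
  rw [div_le_iff₀ two_pos]
  exact_mod_cast h2

theorem cellMoment_zero {d m : ℕ} (q : ℕ) (a : ℝ) (k : Fin d → Fin m) :
    cellMoment q a 0 k = 0 := by
  simp [cellMoment]

theorem bumpSum_zero_single {d m : ℕ} (k : Fin d → Fin m) (t : ℝ) :
    bumpSum 0 (Pi.single k t) = fun x => t * cellBump k x := by
  funext x
  simp [bumpSum, Pi.single_apply]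

theorem moment_bumpSum_single {d m q : ℕ} (hq : q ≠ 0) (k : Fin d → Fin m) (t : ℝ) :
    moment q (bumpSum 0 (Pi.single k t)) = cellMoment q 0 t k := by
  rw [moment_bumpSum, zero_pow hq, zero_add,
    Fintype.sum_eq_single k fun j hj => by rw [Pi.single_eq_of_ne hj, cellMoment_zero],
    Pi.single_eq_same]

theorem card_cells (d m : ℕ) : (Fintype.card (Fin d → Fin m) : ℝ) = (m : ℝ) ^ d := by
  simp

/-- The error forced by bumps of height `b` on single cells. -/
theorem le_minimaxError_of_single {d m n q : ℕ} (hm : 0 < m) (hmn : 2 * n ≤ m ^ d) (hq : q ≠ 0)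
    {b : ℝ} (hb : 0 ≤ b) {F : Set ((Fin d → ℝ) → ℝ)}
    (hF : ∀ (k : Fin d → Fin m) (t : ℝ), |t| ≤ b → bumpSum 0 (Pi.single k t) ∈ F) :
    ENNReal.ofReal (b ^ q * (1 / 2 ^ d / (m : ℝ) ^ d) / 4) ≤ minimaxError d n q F := by
  have : Nonempty (Fin m) := ⟨⟨0, hm⟩⟩
  set B := b ^ q * (1 / 2 ^ d / (m : ℝ) ^ d) with hB
  have hB0 : 0 ≤ B := by positivity
  -- The zero function is counted once per cell, so that every bump is paired with its own copy of
  -- it.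
  refine le_minimaxError_of_average (ι := (Fin d → Fin m) × Bool)
    (fun i => bumpSum 0 (Pi.single i.1 (if i.2 then b else 0))) (fun i => hF _ _ ?_)
    (fun i => (contDiff_bumpSum _ _).continuous.measurable) _ fun H x => ?_
  · split_ifs
    · exact (abs_of_nonneg hb).le
    · simpa using hb
  · obtain ⟨U, hU, hcard⟩ := exists_unseen hmn x
    rw [Fintype.sum_prod_type]
    calc (Fintype.card ((Fin d → Fin m) × Bool) : ℝ) * (B / 4) = (m : ℝ) ^ d / 2 * B := by
          rw [Fintype.card_prod, Nat.cast_mul, card_cells, Fintype.card_bool]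
          push_cast
          ring
      _ ≤ U.card * B := mul_le_mul_of_nonneg_right hcard hB0
      _ = ∑ _k ∈ U, B := by simp
      _ ≤ ∑ k ∈ U, ∑ β : Bool, |H (fun j => bumpSum 0 (Pi.single k (if β then b else 0)) (x j))
            - moment q (bumpSum 0 (Pi.single k (if β then b else 0)))| := by
          refine Finset.sum_le_sum fun k hk => ?_
          have hz : ∀ t : ℝ, (fun j => bumpSum 0 (Pi.single k t) (x j)) = 0 := by
            intro t
            funext j
            simp [bumpSum_zero_single, hU k hk j]
          simp only [Fintype.sum_bool, hz, moment_bumpSum_single hq]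
          have h1 := le_cellMoment_zero hm hq hb k
          rw [← hB] at h1
          simp only [if_true, Bool.false_eq_true, if_false, cellMoment_zero, sub_zero]
          linarith [neg_abs_le (H 0 - cellMoment q 0 b k), le_abs_self (H 0)]
      _ ≤ _ := Finset.sum_le_sum_of_subset_of_nonneg (Finset.subset_univ _)
          fun _ _ _ => Finset.sum_nonneg fun _ _ => abs_nonneg _

/-- The error forced by bumps of height `b` with random signs around the constant `a`. -/
theorem le_minimaxError_of_signs {d m n q : ℕ} (hm : 0 < m) (hmn : 2 * n ≤ m ^ d) (hq : q ≠ 0)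
    {a b : ℝ} (hb : 0 ≤ b) (hab : b ≤ a) {F : Set ((Fin d → ℝ) → ℝ)}
    (hF : ∀ ε : (Fin d → Fin m) → Bool, bumpSum a (fun k => b * boolSign (ε k)) ∈ F) :
    ENNReal.ofReal (2 * a ^ (q - 1) * b * (1 / 2 ^ d / (m : ℝ) ^ d) * √((m : ℝ) ^ d / 2) / 16)
      ≤ minimaxError d n q F := by
  classical
  have ha : 0 ≤ a := hb.trans hab
  set β := 2 * a ^ (q - 1) * b * (1 / 2 ^ d / (m : ℝ) ^ d) with hβ
  have hβ0 : 0 ≤ β := by positivity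
  refine le_minimaxError_of_average (ι := (Fin d → Fin m) → Bool) _ hF
    (fun i => (contDiff_bumpSum _ _).continuous.measurable) _ fun H x => ?_
  obtain ⟨U, hU, hcard⟩ := exists_unseen hmn x
  set f : ((Fin d → Fin m) → Bool) → (Fin d → ℝ) → ℝ :=
    fun ε => bumpSum a (fun k => b * boolSign (ε k)) with hf
  set D : (Fin d → Fin m) → ℝ := fun k => cellMoment q a b k - cellMoment q a (-b) k with hD
  have hdata : ∀ ε, (fun j => f (flipOn U ε) (x j)) = fun j => f ε (x j) := by
    intro ε
    funext j
    simp only [hf, bumpSum]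
    congr 1
    refine Finset.sum_congr rfl fun k _ => ?_
    by_cases hk : k ∈ U
    · simp [hU k hk j]
    · simp [flipOn, hk]
  -- Flipping all unseen signs at once leaves the data alone and turns the moment difference into a
  -- Rademacher sum.
  have hmom : ∀ ε, moment q (f ε) - moment q (f (flipOn U ε)) = ∑ k ∈ U, D k * boolSign (ε k) := by
    intro ε
    simp only [hf, moment_bumpSum]
    rw [add_sub_add_left_eq_sub, ← Finset.sum_sub_distrib]
    symm
    refine Finset.sum_subset_zero_on_sdiff (Finset.subset_univ _) (fun k hk => ?_) fun k hk => ?_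
    · have : k ∉ U := by simpa using hk
      simp [flipOn, this]
    · simp only [flipOn, hk, if_true, hD]
      cases ε k <;> simp [boolSign]
  have hcardι : (Fintype.card ((Fin d → Fin m) → Bool) : ℝ)
      = 2 ^ Fintype.card (Fin d → Fin m) := by
    rw [Fintype.card_fun, Fintype.card_bool]
    push_cast
    rfl
  have hsqrt : β * √((m : ℝ) ^ d / 2) ≤ √(∑ k ∈ U, D k ^ 2) := by
    refine Real.le_sqrt_of_sq_le ?_
    rw [mul_pow, Real.sq_sqrt (by positivity)]
    calc β ^ 2 * ((m : ℝ) ^ d / 2) ≤ β ^ 2 * U.card := by gcongr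
      _ = ∑ _k ∈ U, β ^ 2 := by simp [mul_comm]
      _ ≤ _ := Finset.sum_le_sum fun k _ =>
          pow_le_pow_left₀ hβ0 (le_cellMoment_sub hm hq hb hab k) 2
  have hflip := sum_comp_flipOn U fun ε => |H (fun j => f ε (x j)) - moment q (f ε)|
  -- The estimator gives one value for both `f ε` and its flip, so the two errors sum to at least
  -- the moment difference.
  have hsum : ∑ ε : (Fin d → Fin m) → Bool, |∑ k ∈ U, D k * boolSign (ε k)|
      ≤ 2 * ∑ ε, |H (fun j => f ε (x j)) - moment q (f ε)| := by
    rw [two_mul]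
    nth_rewrite 2 [← hflip]
    rw [← Finset.sum_add_distrib]
    refine Finset.sum_le_sum fun ε _ => ?_
    rw [hdata, ← hmom, abs_sub_comm (H _) (moment q (f ε))]
    exact abs_sub_le _ _ _
  have hK := khintchine_one D U
  rw [hcardι]
  have h2 : (0 : ℝ) < 2 ^ Fintype.card (Fin d → Fin m) := by positivity
  nlinarith [mul_le_mul_of_nonneg_left hsqrt h2.le]

/-! ### Small functions in the Sobolev ball -/

/-- The height factor `m^(-s)` pays for up to `s` derivatives, and on a probability space the sup
bound controls every `L^p` norm. -/
theorem bumpSum_mem_sobolevBall {d m s : ℕ} (hm : 0 < m) {p R : ℝ≥0∞} {a : ℝ} (ha : 0 ≤ a)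
    {C : (Fin d → ℕ) → ℝ}
    (hC : ∀ α y, |listDeriv (multiList α).reverse (cubeBump d) y| ≤ C α)
    (hR : ∑ α ∈ multiIndices d s, ENNReal.ofReal (a * (1 + C α)) ≤ R)
    {θ : (Fin d → Fin m) → ℝ} (hθ : ∀ k, |θ k| ≤ a * ((m : ℝ) ^ s)⁻¹) :
    bumpSum a θ ∈ sobolevBall d s p R := by
  refine mem_sobolevBall_of_contDiff (contDiff_bumpSum a θ) _ (fun α hα => ?_) hR
  refine (eLpNorm_le_of_support_subset (subset_univ _)
    (abs_listDeriv_bumpSum_le (by positivity) hθ (hC α))).trans ?_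
  rw [measure_univ, ENNReal.one_rpow, one_mul]
  refine ENNReal.ofReal_le_ofReal ?_
  have hm1 : (1 : ℝ) ≤ m := by exact_mod_cast hm
  have hC0 : 0 ≤ C α := (abs_nonneg _).trans (hC α 0)
  have h1 : ((m : ℝ) ^ s)⁻¹ * (m : ℝ) ^ (multiList α).reverse.length ≤ 1 := by
    rw [List.length_reverse, length_multiList, inv_mul_le_one₀ (by positivity)]
    exact pow_le_pow_right₀ hm1 hα
  rw [abs_of_nonneg ha, mul_assoc a, mul_add, mul_one]
  gcongr
  exact mul_le_of_le_one_right ha h1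

/-- The support has measure at most `m^(-d)`, so the `L^p` norm gains `m^(-d/p)`, which the extra
height uses up. -/
theorem bumpSum_single_mem_sobolevBall {d m s : ℕ} (hm : 0 < m) {p : ℝ} (hp : 0 < p) {R : ℝ≥0∞}
    {a : ℝ} (ha : 0 ≤ a) {C : (Fin d → ℕ) → ℝ}
    (hC : ∀ α y, |listDeriv (multiList α).reverse (cubeBump d) y| ≤ C α)
    (hR : ∑ α ∈ multiIndices d s, ENNReal.ofReal (a * (1 + C α)) ≤ R)
    (k : Fin d → Fin m) {t : ℝ} (ht : |t| ≤ a * ((m : ℝ) ^ s)⁻¹ * ((m : ℝ) ^ d) ^ p⁻¹) :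
    bumpSum 0 (Pi.single k t) ∈ sobolevBall d s (ENNReal.ofReal p) R := by
  refine mem_sobolevBall_of_contDiff (contDiff_bumpSum _ _) _ (fun α hα => ?_) hR
  have hm0 : (0 : ℝ) < m := by exact_mod_cast hm
  have hm1 : (1 : ℝ) ≤ m := by exact_mod_cast hm
  have hC0 : 0 ≤ C α := (abs_nonneg _).trans (hC α 0)
  set l := (multiList α).reverse with hl
  set S := Metric.closedBall (fun i => ((k i : ℝ) + 1 / 2) / m) (1 / (2 * (m : ℝ))) with hS
  have hsupp : Function.support (listDeriv l (bumpSum 0 (Pi.single k t))) ⊆ S := by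
    refine subset_trans (fun x hx => ?_) (support_listDeriv_cellBump_subset hm l k)
    have e : bumpSum 0 (Pi.single k t) = fun x => ∑ k' ∈ {k}, t * cellBump k' x := by
      rw [bumpSum_zero_single]
      simp
    rw [Function.mem_support, e,
      listDeriv_sum {k} (fun _ => t) cellBump contDiff_cellBump] at hx
    simp only [Finset.sum_singleton] at hx
    exact right_ne_zero_of_mul hx
  have hvol : uniformCube d S ≤ ENNReal.ofReal ((m : ℝ) ^ d)⁻¹ := by
    refine (Measure.restrict_apply_le _ _).trans ?_
    rw [Real.volume_pi_closedBall _ (by positivity), Fintype.card_fin,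
      show 2 * (1 / (2 * (m : ℝ))) = (m : ℝ)⁻¹ by field_simp, inv_pow]
  have hsingle : ∀ k', |(Pi.single k t : (Fin d → Fin m) → ℝ) k'|
      ≤ a * ((m : ℝ) ^ s)⁻¹ * ((m : ℝ) ^ d) ^ p⁻¹ := by
    intro k'
    rw [Pi.single_apply]
    split_ifs
    · exact ht
    · rw [abs_zero]
      positivity
  refine (eLpNorm_le_of_support_subset hsupp
    (abs_listDeriv_bumpSum_le (by positivity) hsingle (hC α))).trans ?_
  rw [ENNReal.toReal_ofReal hp.le]
  refine (mul_le_mul_left (ENNReal.rpow_le_rpow hvol (by positivity)) _).trans ?_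
  rw [ENNReal.ofReal_rpow_of_pos (by positivity), ← ENNReal.ofReal_mul (by positivity)]
  refine ENNReal.ofReal_le_ofReal ?_
  have h1 : ((m : ℝ) ^ s)⁻¹ * (m : ℝ) ^ l.length ≤ 1 := by
    rw [hl, List.length_reverse, length_multiList, inv_mul_le_one₀ (by positivity)]
    exact pow_le_pow_right₀ hm1 hα
  have hX : ((m : ℝ) ^ d) ^ p⁻¹ ≠ 0 := (by positivity : (0 : ℝ) < ((m : ℝ) ^ d) ^ p⁻¹).ne'
  rw [Real.inv_rpow (by positivity)]
  calc (((m : ℝ) ^ d) ^ p⁻¹)⁻¹ * (|0| + a * ((m : ℝ) ^ s)⁻¹ * ((m : ℝ) ^ d) ^ p⁻¹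
        * (m : ℝ) ^ l.length * C α)
      = (a * C α) * (((m : ℝ) ^ s)⁻¹ * (m : ℝ) ^ l.length) := by
        rw [abs_zero, zero_add]
        field_simp
    _ ≤ a * C α := mul_le_of_le_one_right (by positivity) h1
    _ ≤ a * (1 + C α) := by gcongr; linarith

/-- A grid with at least `2n` but not many more cells. -/
theorem exists_grid {d n : ℕ} (hd : 0 < d) (hn : 1 ≤ n) :
    ∃ m : ℕ, 0 < m ∧ 2 * n ≤ m ^ d ∧ m ^ d ≤ 2 ^ (d + 1) * n := by
  classical
  have hex : ∃ m : ℕ, 2 * n ≤ m ^ d := ⟨2 * n, Nat.le_self_pow hd.ne' _⟩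
  have h1 := Nat.find_spec hex
  have h2 := fun j => Nat.find_min hex (m := j)
  generalize Nat.find hex = m at h1 h2
  have hm : 2 ≤ m := by
    by_contra h
    have : m ^ d ≤ 1 ^ d := Nat.pow_le_pow_left (by omega) d
    rw [one_pow] at this
    omega
  refine ⟨m, by omega, h1, ?_⟩
  -- Minimality gives `(m - 1)^d < 2n`, and `m ≤ 2(m - 1)` because `m ≥ 2`.
  have h3 := h2 (m - 1) (by omega)
  calc m ^ d ≤ (2 * (m - 1)) ^ d := Nat.pow_le_pow_left (by omega) d
    _ = 2 ^ d * (m - 1) ^ d := mul_pow _ _ _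
    _ ≤ 2 ^ d * (2 * n) := Nat.mul_le_mul_left _ (by omega)
    _ = 2 ^ (d + 1) * n := by ring

theorem theorem2p1 (d : ℕ) (hd : 0 < d) (s q : ℕ) (p : ℝ) (hp : 2 < p)
    (hqp : (q : ℝ) < p) (hpq : p < 2 * (q : ℝ)) (R : ℝ≥0∞) (hR : 0 < R) :
    ∃ c : ℝ, 0 < c ∧ ∀ n : ℕ, 1 ≤ n →
      ENNReal.ofReal (c * (n : ℝ) ^
          max (-(q : ℝ) * ((s : ℝ) / (d : ℝ) - 1 / p) - 1) (-1 / 2 - (s : ℝ) / (d : ℝ)))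
        ≤ minimaxError d n q (sobolevBall d s (ENNReal.ofReal p) R) := by
  have hp0 : 0 < p := by linarith
  have hd0 : (0 : ℝ) < d := by exact_mod_cast hd
  have hq : q ≠ 0 := by
    rintro rfl
    norm_num at hpq
    linarith
  choose C hC0 hC using fun α : Fin d → ℕ =>
    exists_bound_listDeriv_cubeBump (multiList α).reverse
  obtain ⟨a, ha, haR⟩ : ∃ a : ℝ, 0 < a ∧
      ∑ α ∈ multiIndices d s, ENNReal.ofReal (a * (1 + C α)) ≤ R := by
    have hT : 0 < ∑ α ∈ multiIndices d s, (1 + C α) :=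
      Finset.sum_pos (fun α _ => by linarith [hC0 α]) ⟨0, mem_multiIndices.2 (by simp)⟩
    -- Truncating the radius at one covers `R = ∞`.
    have hr : min R 1 ≠ ⊤ := ne_top_of_le_ne_top ENNReal.one_ne_top (min_le_right _ _)
    have hr0 : 0 < (min R 1).toReal :=
      ENNReal.toReal_pos (lt_min hR zero_lt_one).ne' hr
    refine ⟨(min R 1).toReal / ∑ α ∈ multiIndices d s, (1 + C α), by positivity, ?_⟩
    rw [← ENNReal.ofReal_sum_of_nonneg fun α _ => mul_nonneg (by positivity) (by linarith [hC0 α]),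
      ← Finset.mul_sum, div_mul_cancel₀ _ hT.ne', ENNReal.ofReal_toReal hr]
    exact min_le_left _ _
  set E₁ := -(q : ℝ) * ((s : ℝ) / (d : ℝ) - 1 / p) - 1 with hE₁
  set E₂ := -1 / 2 - (s : ℝ) / (d : ℝ) with hE₂
  have hsd : (0 : ℝ) ≤ s / d := by positivity
  -- Nonpositive exponents are needed to pass from `X ≤ K * n` to a lower bound for `X ^ E`; here
  -- this rests on `q < p`.
  have hE₁0 : E₁ ≤ 0 := by
    have h1 : (q : ℝ) * (1 / p) ≤ 1 := by
      rw [mul_one_div, div_le_one hp0]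
      exact hqp.le
    have h2 : 0 ≤ (q : ℝ) * (s / d) := by positivity
    rw [hE₁]
    linarith
  have hE₂0 : E₂ ≤ 0 := by
    rw [hE₂]
    linarith
  set c₁ := a ^ q / 2 ^ d / 4 with hc₁
  set c₂ := 2 * a ^ q / 2 ^ d / √2 / 16 with hc₂
  set K : ℝ := 2 ^ (d + 1) with hK
  have hc₁0 : 0 < c₁ := by positivity
  have hc₂0 : 0 < c₂ := by positivity
  have hK0 : 0 < K := by positivity
  refine ⟨min (c₁ * K ^ E₁) (c₂ * K ^ E₂), by positivity, fun n hn => ?_⟩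
  obtain ⟨m, hm, hmn, hmK⟩ := exists_grid hd hn
  have hm0 : (0 : ℝ) < m := by exact_mod_cast hm
  have hn0 : (0 : ℝ) < n := by exact_mod_cast hn
  set X : ℝ := (m : ℝ) ^ d with hX
  have hX0 : 0 < X := by positivity
  have hXK : X ≤ K * n := by
    rw [hX, hK]
    exact_mod_cast hmK
  have hpow : ∀ E : ℝ, E ≤ 0 → K ^ E * (n : ℝ) ^ E ≤ X ^ E := fun E hE => by
    rw [← Real.mul_rpow hK0.le hn0.le]
    exact Real.rpow_le_rpow_of_nonpos hX0 hXK hE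
  have hms : (m : ℝ) ^ s = X ^ ((s : ℝ) / d) := by
    rw [hX, ← Real.rpow_natCast, ← Real.rpow_natCast, ← Real.rpow_mul hm0.le,
      mul_div_cancel₀ _ hd0.ne']
  have hsingle : ENNReal.ofReal (c₁ * X ^ E₁)
      ≤ minimaxError d n q (sobolevBall d s (ENNReal.ofReal p) R) := by
    refine le_trans (ENNReal.ofReal_le_ofReal (le_of_eq ?_))
      (le_minimaxError_of_single (b := a * ((m : ℝ) ^ s)⁻¹ * X ^ p⁻¹) hm hmn hq (by positivity)
        fun k t => bumpSum_single_mem_sobolevBall hm hp0 ha.le hC haR k)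
    have e : X ^ E₁ = ((X ^ ((s : ℝ) / d))⁻¹ * X ^ p⁻¹) ^ q * X⁻¹ := by
      rw [← Real.rpow_neg hX0.le, ← Real.rpow_add hX0, ← Real.rpow_mul_natCast hX0.le,
        ← Real.rpow_neg_one X, ← Real.rpow_add hX0, hE₁]
      congr 1
      ring
    rw [hms, e, hc₁, mul_pow, mul_pow, mul_pow]
    ring
  have hsigns : ENNReal.ofReal (c₂ * X ^ E₂)
      ≤ minimaxError d n q (sobolevBall d s (ENNReal.ofReal p) R) := by
    have hle : a * ((m : ℝ) ^ s)⁻¹ ≤ a :=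
      mul_le_of_le_one_right ha.le (inv_le_one_of_one_le₀ (one_le_pow₀ (by exact_mod_cast hm)))
    refine le_trans (ENNReal.ofReal_le_ofReal (le_of_eq ?_))
      (le_minimaxError_of_signs (b := a * ((m : ℝ) ^ s)⁻¹) (a := a) hm hmn hq (by positivity) hle
        fun ε => bumpSum_mem_sobolevBall hm ha.le hC haR fun k => ?_)
    · have e : X ^ E₂ = (X ^ ((s : ℝ) / d))⁻¹ * X⁻¹ * √X := by
        rw [Real.sqrt_eq_rpow, ← Real.rpow_neg hX0.le, ← Real.rpow_neg_one X, ← Real.rpow_add hX0,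
          ← Real.rpow_add hX0, hE₂]
        congr 1
        ring
      have e2 : a ^ q = a ^ (q - 1) * a := (pow_sub_one_mul hq a).symm
      rw [hms, e, hc₂, ← hX, Real.sqrt_div hX0.le, e2]
      ring
    · have : |boolSign (ε k)| = 1 := by cases ε k <;> simp [boolSign]
      rw [abs_mul, this, mul_one, abs_of_nonneg (by positivity)]
  rcases max_choice E₁ E₂ with h | h <;> rw [h]
  · refine le_trans (ENNReal.ofReal_le_ofReal ?_) hsingle
    calc min (c₁ * K ^ E₁) (c₂ * K ^ E₂) * (n : ℝ) ^ E₁ ≤ c₁ * K ^ E₁ * (n : ℝ) ^ E₁ := by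
          gcongr
          exact min_le_left _ _
      _ ≤ c₁ * X ^ E₁ := by
          rw [mul_assoc]
          exact mul_le_mul_of_nonneg_left (hpow E₁ hE₁0) hc₁0.le
  · refine le_trans (ENNReal.ofReal_le_ofReal ?_) hsigns
    calc min (c₁ * K ^ E₁) (c₂ * K ^ E₂) * (n : ℝ) ^ E₂ ≤ c₂ * K ^ E₂ * (n : ℝ) ^ E₂ := by
          gcongr
          exact min_le_right _ _
      _ ≤ c₂ * X ^ E₂ := by
          rw [mul_assoc]
          exact mul_le_mul_of_nonneg_left (hpow E₂ hE₂0) hc₂0.le
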